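/- For a real sequence $(x_n)_{n\ge 1}$ let $B_{n,k}(x_1,x_2,\dots)$ denote the (exponential) partial Bell polynomials, defined by $$\sum_{n\ge k} B_{n,k}(x_1,x_2,\dots)\frac{t^n}{n!}=\frac1{k!}\Big(\sum_{m\ge1}x_m\frac{t^m}{m!}\Big)^k ,$$ and write $B(n,k):=B_{n,k}(x_1,x_2,\dots)$. Say that a family $(Y(n,k))_{n\ge k\ge1}$ satisfies (h) if $$B_{n,k}\big(Y(1,1),Y(2,1),Y(3,1),\dots\big)=Y(n,k)\qquad\text{for all } n\ge k\ge 1. \tag{h}$$ Let $(x_n)_{n\ge1}$ be any real sequence, let $r,s\ge0$ be integers with $r+s\ge1$, and put $T=T(n,k):=r(n-k)+sk$. (z1) For all real $b,c$, the family $$Y(n,k):=\frac{sk}{T}\binom nk\binom{T+n-k}{n-k}^{-1}\sum_{j=0}^{n-k}\binom{T+j-1}{T-1}B(T+n-k,T+j)\,\big(((r+1)c-b)j+y\big)\,y^{\,j-1},\qquad y:=b(n-k)+csk,$$ satisfies (h). Here $\big(((r+1)c-b)j+y\big)y^{j-1}$ is read as $y^j+((r+1)c-b)\,j\,y^{j-1}$,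 whose value at $j=0$ is $1$, also when $y=0$. (z2) In particular, for every real $z$, the family $$Y(n,k):=\frac{sk}{T}\binom nk\binom{T+n-k}{n-k}^{-1}\sum_{j=0}^{n-k}\binom{T+j-1}{T-1}B(T+n-k,T+j)\,(T+n-k)^j z^j$$ satisfies (h). (When $s=0$ and $n=k$, so that $T=0$, the quotient $sk/T$ and the binomial coefficient $\binom{-1}{-1}$ are both read as $1$; also $0^0=1$.) -/

import Mathlib

noncomputable section

namespace BellIdentities

/-- The exponential partial Bell polynomial `B_{n,k}(x_1, x_2, …)`, defined by its generating
function `∑_n B_{n,k} t^n / n! = (1/k!) (∑_{m ≥ 1} x_m t^m / m!)^k`. Sequences are indexed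
by `m ≥ 1`; the value `x 0` is ignored. -/
def partialBell (x : ℕ → ℝ) (n k : ℕ) : ℝ :=
  (n.factorial : ℝ) *
    PowerSeries.coeff n
      (PowerSeries.C (1 / (k.factorial : ℝ)) *
        (PowerSeries.mk fun m : ℕ => if m = 0 then (0 : ℝ) else x m / (m.factorial : ℝ)) ^ k)

/-- The equation `B_{n,k}(Y(1,1), Y(2,1), Y(3,1), …) = Y(n,k)` for all `n ≥ k ≥ 1`. -/
def SatisfiesBellEq (Y : ℕ → ℕ → ℝ) : Prop :=
  ∀ n k : ℕ, 1 ≤ k → k ≤ n → partialBell (fun m => Y m 1) n k = Y n k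

/-- `T(n,k) = r (n - k) + s k`, used only for `k ≤ n`. -/
def T (r s n k : ℕ) : ℕ := r * (n - k) + s * k

/-- The quotient `s k / T(n,k)`. Its denominator vanishes (for `r + s ≥ 1`, `n ≥ k ≥ 1`) only
if `s = 0` and `n = k`; there it takes the value `1`, which is its value at `n = k` for every
`s ≥ 1`. -/
def ratio (r s n k : ℕ) : ℝ :=
  if T r s n k = 0 then 1 else ((s * k : ℕ) : ℝ) / (T r s n k : ℝ)

/-- The common factor `(s k / T) C(n,k) C(T + n - k, n - k)⁻¹`. -/
def prefactor (r s n k : ℕ) : ℝ :=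
  ratio r s n k * (n.choose k : ℝ) * (((T r s n k + (n - k)).choose (n - k) : ℕ) : ℝ)⁻¹

/-- The sequence with parameters `b`, `c`. With `y = b (n - k) + c s k`, the last factor of the
summand is `(((r + 1) c - b) j + y) y ^ (j - 1)`, written in the expanded form
`y ^ j + ((r + 1) c - b) j y ^ (j - 1)`, so that it is `1` for `j = 0` even if `y = 0`.
For `T = 0` only `j = 0` occurs, and the truncated binomial coefficient is `1`. -/
def Ybc (x : ℕ → ℝ) (r s : ℕ) (b c : ℝ) (n k : ℕ) : ℝ :=
  let y : ℝ := b * ((n - k : ℕ) : ℝ) + c * (s : ℝ) * (k : ℝ)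
  prefactor r s n k *
    ∑ j ∈ Finset.range (n - k + 1),
      ((T r s n k + j - 1).choose (T r s n k - 1) : ℝ) *
        partialBell x (T r s n k + (n - k)) (T r s n k + j) *
        (y ^ j + (((r : ℝ) + 1) * c - b) * (j : ℝ) * y ^ (j - 1))

/-- The special sequence with one real parameter `z`. -/
def Yz (x : ℕ → ℝ) (r s : ℕ) (z : ℝ) (n k : ℕ) : ℝ :=
  prefactor r s n k *
    ∑ j ∈ Finset.range (n - k + 1),
      ((T r s n k + j - 1).choose (T r s n k - 1) : ℝ) *
        partialBell x (T r s n k + (n - k)) (T r s n k + j) *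
        ((T r s n k + (n - k) : ℕ) : ℝ) ^ j * z ^ j

end BellIdentities

end

namespace BellIdentities

open PowerSeries

/-! Put `g = ∑ x (m+1) X^m / (m+1)!`. Then `B(k+N, k) = (k+N)!/k! · [X^N] g^k`, so (h) holds once a
single series `G` gives `Y(k+N, k) = (k+N)!/k! · [X^N] G^k` for all `k ≥ 1`, `N ≥ 0`. Such a `G` is
`H^s`, where `H(z) = F(t)`, `t = z φ(t)`, `φ = g^r exp(bXg)` and `F = g exp(cXg)`. Lagrange
inversion gives `N [X^N] H^u = [X^N] X (F^u)' φ^N`; with `u = sk`, expanding `exp(yXg)`, `y = bN +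
cu`, produces the sum defining `Ybc`. -/

/-! ### Formal Lagrange inversion. -/

theorem coeff_X_mul_derivative (f : ℝ⟦X⟧) (m : ℕ) :
    coeff m (X * derivative ℝ f) = m * coeff m f := by
  cases m with
  | zero => simp
  | succ m => rw [coeff_succ_X_mul, coeff_derivative]; push_cast; ring

theorem coeff_X_mul_derivative_mul_pow (g : ℝ⟦X⟧) (m n : ℕ) :
    coeff m (X * derivative ℝ g * g ^ n) = m / (n + 1) * coeff m (g ^ (n + 1)) := by
  have h := coeff_X_mul_derivative (g ^ (n + 1)) m
  rw [derivative_pow] at h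
  have e : X * (((n + 1 : ℕ) : ℝ⟦X⟧) * g ^ (n + 1 - 1) * derivative ℝ g)
      = C ((n : ℝ) + 1) * (X * derivative ℝ g * g ^ n) := by
    rw [Nat.add_sub_cancel]; push_cast; simp; ring
  rw [e, coeff_C_mul] at h
  have hn : (n : ℝ) + 1 ≠ 0 := by positivity
  field_simp
  linarith

/-- The residue computation behind Lagrange inversion, for a power of `w = X / φ`. -/
theorem coeff_pow_mul_derivative_mul_pow {φ ψ : ℝ⟦X⟧} (h : φ * ψ = 1) (i m : ℕ) :
    coeff (i + m) ((X * ψ) ^ i * (derivative ℝ (X * ψ) * φ ^ (i + m + 1)))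
      = if m = 0 then 1 else 0 := by
  have hd : derivative ℝ ψ * φ = - (derivative ℝ φ * ψ) := by
    have h1 := congrArg (derivative ℝ) h
    rw [Derivation.leibniz, derivative_one] at h1
    simp only [smul_eq_mul] at h1
    linear_combination h1
  have hi : φ ^ i * ψ ^ i = 1 := by rw [← mul_pow, h, one_pow]
  have e : (X * ψ) ^ i * (derivative ℝ (X * ψ) * φ ^ (i + m + 1))
      = X ^ i * (φ ^ m - X * derivative ℝ φ * (φ ^ m * ψ)) := by
    rw [Derivation.leibniz, derivative_X]
    simp only [smul_eq_mul]
    calc _ = X ^ i * (φ ^ i * ψ ^ i) * ((φ * ψ) * φ ^ m + X * (derivative ℝ ψ * φ) * φ ^ m) := by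
            ring
      _ = _ := by rw [hd, hi, h]; ring
  rw [e, add_comm, coeff_X_pow_mul]
  cases m with
  | zero => simp [mul_assoc]
  | succ m =>
    -- `X φ' φ^m` and `φ^(m+1)` have the same coefficient at `m+1`, so the difference cancels.
    have : φ ^ (m + 1) * ψ = φ ^ m := by rw [pow_succ, mul_assoc, h, mul_one]
    rw [this, map_sub, coeff_X_mul_derivative_mul_pow]
    have hn : (m : ℝ) + 1 ≠ 0 := by positivity
    rw [if_neg (Nat.succ_ne_zero m)]
    push_cast
    field_simp
    ring

theorem hasSubst_X_mul (g : ℝ⟦X⟧) : HasSubst (X * g) :=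
  HasSubst.of_constantCoeff_zero' (by simp)

/-- Powers of `X * g` beyond the `N`-th do not reach degree `N`, so `D` may be truncated to a
polynomial. -/
theorem coeff_subst_X_mul_mul (g D P : ℝ⟦X⟧) (N : ℕ) :
    coeff N (D.subst (X * g) * P)
      = ∑ j ∈ Finset.range (N + 1), coeff j D * coeff N ((X * g) ^ j * P) := by
  have hw := hasSubst_X_mul g
  have hD : D = X ^ (N + 1) * mk (fun i => coeff (i + (N + 1)) D)
      + ((trunc (N + 1) D : Polynomial ℝ) : ℝ⟦X⟧) := eq_X_pow_mul_shift_add_trunc (N + 1) D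
  have hX : (X : ℝ⟦X⟧).subst (X * g) = X * g := subst_X hw
  have h2 : ∀ Q : ℝ⟦X⟧, coeff N ((X * g) ^ (N + 1) * Q * P) = 0 := by
    intro Q
    rw [mul_pow, mul_assoc, mul_assoc, coeff_X_pow_mul', if_neg (by omega)]
  conv_lhs => rw [hD]
  rw [subst_add hw, subst_mul hw, subst_pow hw, hX, add_mul, map_add, h2, zero_add, subst_coe hw,
    Polynomial.aeval_eq_sum_range' (natDegree_trunc_lt D N), Finset.sum_mul, map_sum]
  refine Finset.sum_congr rfl fun j hj => ?_
  rw [Finset.mem_range] at hj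
  rw [smul_mul_assoc, coeff_smul, coeff_trunc, if_pos hj, smul_eq_mul]

/-- Invariance of the residue of `D(w) dw / w^(M+1)` under `w = X ψ`. -/
theorem coeff_subst_mul_derivative_mul_pow {φ ψ : ℝ⟦X⟧} (h : φ * ψ = 1) (D : ℝ⟦X⟧) (M : ℕ) :
    coeff M (D.subst (X * ψ) * (derivative ℝ (X * ψ) * φ ^ (M + 1))) = coeff M D := by
  have key : ∀ i, coeff M ((X * ψ) ^ i * (derivative ℝ (X * ψ) * φ ^ (M + 1)))
      = if i = M then 1 else 0 := by
    intro i
    rcases le_or_gt i M with hi | hi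
    · obtain ⟨m, rfl⟩ := Nat.exists_eq_add_of_le hi
      rw [coeff_pow_mul_derivative_mul_pow h]
      simp
    · rw [mul_pow, mul_assoc, coeff_X_pow_mul', if_neg (by omega), if_neg (by omega)]
  rw [coeff_subst_X_mul_mul]
  simp only [key]
  simp

/-- Lagrange inversion: `H` is `F` evaluated at the solution `t` of `t = z φ(t)`. -/
theorem exists_lagrange_inversion (φ F : ℝ⟦X⟧) : ∃ H : ℝ⟦X⟧, ∀ k : ℕ,
    constantCoeff (H ^ k) = constantCoeff (F ^ k) ∧
    ∀ N : ℕ, N * coeff N (H ^ k) = coeff N (X * derivative ℝ (F ^ k) * φ ^ N) := by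
  by_cases h0 : constantCoeff φ = 0
  -- Here `t = z φ(t)` has the solution `t = 0`, so `H` is constant.
  · refine ⟨C (constantCoeff F), fun k => ⟨by simp, fun N => ?_⟩⟩
    obtain ⟨χ, rfl⟩ := X_dvd_iff.2 h0
    rw [mul_pow, mul_comm _ (X ^ N * _), mul_assoc, coeff_X_pow_mul', if_pos le_rfl, ← map_pow,
      coeff_C]
    cases N <;> simp
  · have h : φ * φ⁻¹ = 1 := PowerSeries.mul_inv_cancel _ h0
    have hw : HasSubst (X * φ⁻¹) := HasSubst.of_constantCoeff_zero' (by simp)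
    have hu : IsUnit (coeff 1 (X * φ⁻¹)) := by
      rw [← zero_add 1, coeff_succ_X_mul]
      simpa using h0
    have hc : constantCoeff (X * φ⁻¹) = 0 := by simp
    have hv : HasSubst (substInvOfIsUnit (X * φ⁻¹) hu) := HasSubst.substInvOfIsUnit (X * φ⁻¹) hu
    refine ⟨F.subst (substInvOfIsUnit (X * φ⁻¹) hu), fun k => ?_⟩
    set H := F.subst (substInvOfIsUnit (X * φ⁻¹) hu) with hH
    have hF : F ^ k = PowerSeries.subst (X * φ⁻¹ : ℝ⟦X⟧) (H ^ k) := by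
      rw [subst_pow hw, hH, subst_comp_subst_apply hv hw, subst_substInvOfIsUnit_left (X * φ⁻¹) hc hu,
        X_subst]
    constructor
    · rw [hF, ← coeff_zero_eq_constantCoeff_apply, ← coeff_zero_eq_constantCoeff_apply]
      rw [coeff_subst' hw, finsum_eq_single _ 0]
      · simp
      · intro n hn
        simp [hn]
    · intro N
      cases N with
      | zero => simp
      | succ M =>
        rw [hF, derivative_subst hw, mul_assoc, coeff_succ_X_mul, mul_assoc,
          coeff_subst_mul_derivative_mul_pow h, coeff_derivative]
        push_cast; ring

/-! ### Exponential series and the explicit Lagrange coefficients. -/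

/-- The series `exp (y X g)`. -/
noncomputable def expMul (g : ℝ⟦X⟧) (y : ℝ) : ℝ⟦X⟧ := (rescale y (PowerSeries.exp ℝ)).subst (X * g)

theorem expMul_zero (g : ℝ⟦X⟧) : expMul g 0 = 1 := by
  rw [expMul, rescale_zero]
  simp [← coe_substAlgHom (hasSubst_X_mul g)]

theorem expMul_add (g : ℝ⟦X⟧) (y z : ℝ) : expMul g (y + z) = expMul g y * expMul g z := by
  rw [expMul, expMul, expMul, ← subst_mul (hasSubst_X_mul g), exp_mul_exp_eq_exp_add]

theorem expMul_pow (g : ℝ⟦X⟧) (y : ℝ) (k : ℕ) : expMul g y ^ k = expMul g (k * y) := by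
  induction k with
  | zero => simp [expMul_zero]
  | succ k ih => rw [pow_succ, ih, ← expMul_add]; push_cast; ring_nf

theorem derivative_expMul (g : ℝ⟦X⟧) (y : ℝ) :
    derivative ℝ (expMul g y) = C y * (g + X * derivative ℝ g) * expMul g y := by
  have hg := hasSubst_X_mul g
  have h : derivative ℝ (rescale y (PowerSeries.exp ℝ)) = y • rescale y (PowerSeries.exp ℝ) := by
    ext n
    rw [coeff_derivative, coeff_smul, coeff_rescale, coeff_rescale, coeff_exp, coeff_exp,
      Nat.factorial_succ]
    have : (n : ℝ) + 1 ≠ 0 := by positivity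
    have : (n.factorial : ℝ) ≠ 0 := by positivity
    simp only [eq_ratCast, smul_eq_mul]
    push_cast
    field_simp
    ring
  rw [expMul, derivative_subst hg, h, subst_smul hg, Derivation.leibniz, derivative_X,
    smul_eq_C_mul]
  simp only [smul_eq_mul]
  ring

theorem coeff_expMul_mul (g P : ℝ⟦X⟧) (y : ℝ) (N : ℕ) :
    coeff N (expMul g y * P)
      = ∑ j ∈ Finset.range (N + 1), y ^ j / j.factorial * coeff (N - j) (g ^ j * P) := by
  rw [expMul, coeff_subst_X_mul_mul]
  refine Finset.sum_congr rfl fun j hj => ?_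
  rw [Finset.mem_range] at hj
  rw [mul_pow, mul_assoc, coeff_X_pow_mul', if_pos (by omega), coeff_rescale, coeff_exp]
  simp [div_eq_mul_inv]

/-- The coefficient formula obtained from Lagrange inversion for `φ = g ^ r exp (b X g)` and
`F = g exp (c X g)`. -/
theorem coeff_X_mul_derivative_mul_expMul (g : ℝ⟦X⟧) (b c : ℝ) (r u N : ℕ) (hu : u ≠ 0) :
    coeff N (X * derivative ℝ ((g * expMul g c) ^ u) * (g ^ r * expMul g b) ^ N)
      = N * (u * ∑ j ∈ Finset.range (N + 1),
          coeff (N - j) (g ^ (r * N + u + j)) / (((r * N + u + j : ℕ) : ℝ) * j.factorial) *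
          ((b * N + c * u) ^ j
            + (((r : ℝ) + 1) * c - b) * j * (b * N + c * u) ^ (j - 1))) := by
  obtain ⟨v, rfl⟩ := Nat.exists_eq_succ_of_ne_zero hu
  set y : ℝ := b * N + c * (v.succ : ℕ) with hy
  set a : ℕ := r * N + v with ha
  set A : ℕ → ℝ := fun j => coeff (N - j) (g ^ (a + 1 + j)) with hA
  have e : X * derivative ℝ ((g * expMul g c) ^ v.succ) * (g ^ r * expMul g b) ^ N
      = C (v.succ : ℝ) * (expMul g y * (X * derivative ℝ g * g ^ a)
        + C c * (expMul g y * (X * (g + X * derivative ℝ g) * g ^ (a + 1)))) := by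
    have hE : expMul g y = expMul g c ^ v.succ * expMul g b ^ N := by
      rw [expMul_pow, expMul_pow, ← expMul_add, hy]; ring_nf
    rw [derivative_pow, Derivation.leibniz, derivative_expMul, hE, ha]
    simp only [smul_eq_mul, Nat.succ_eq_add_one, Nat.add_sub_cancel]
    have : (C ((v + 1 : ℕ) : ℝ) : ℝ⟦X⟧) = ((v + 1 : ℕ) : ℝ⟦X⟧) := by simp
    rw [this]
    ring
  have h1 : ∀ j, coeff (N - j) (g ^ j * (X * derivative ℝ g * g ^ a))
      = ((N - j : ℕ) : ℝ) / (a + j + 1) * A j := by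
    intro j
    rw [show g ^ j * (X * derivative ℝ g * g ^ a) = X * derivative ℝ g * g ^ (a + j) by ring,
      coeff_X_mul_derivative_mul_pow, hA]
    push_cast
    ring_nf
  have h2 : ∀ j < N, coeff (N - j) (g ^ j * (X * (g + X * derivative ℝ g) * g ^ (a + 1)))
      = ((a : ℝ) + 1 + N) / (a + j + 2) * A (j + 1) := by
    intro j hj
    obtain ⟨i, rfl⟩ := Nat.exists_eq_add_of_lt hj
    rw [show g ^ j * (X * (g + X * derivative ℝ g) * g ^ (a + 1))
        = X * (g ^ (a + 1 + (j + 1)) + X * derivative ℝ g * g ^ (a + 1 + j)) by ring,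
      show j + i + 1 - j = i + 1 by omega, coeff_succ_X_mul, map_add,
      coeff_X_mul_derivative_mul_pow]
    simp only [hA]
    rw [show j + i + 1 - (j + 1) = i by omega, show a + 1 + j + 1 = a + 1 + (j + 1) by ring]
    have : (a : ℝ) + j + 2 ≠ 0 := by positivity
    have : (a : ℝ) + 1 + j + 1 ≠ 0 := by positivity
    push_cast
    field_simp
    ring
  rw [e, coeff_C_mul, map_add, coeff_C_mul, coeff_expMul_mul, coeff_expMul_mul,
    Finset.sum_range_succ (fun j => y ^ j / _ * coeff (N - j) (g ^ j * (X * (_ + _) * _))) N]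
  have h3 : coeff (N - N) (g ^ N * (X * (g + X * derivative ℝ g) * g ^ (a + 1))) = 0 := by simp
  rw [h3, mul_zero, add_zero, mul_left_comm (N : ℝ)]
  congr 1
  have hB : ∀ B : ℕ → ℝ, B 0 = 0 →
      ∑ j ∈ Finset.range N, B (j + 1) = ∑ j ∈ Finset.range (N + 1), B j := by
    intro B hB
    rw [Finset.sum_range_succ', hB, add_zero]
  have h4 : c * ∑ j ∈ Finset.range N, y ^ j / j.factorial *
        coeff (N - j) (g ^ j * (X * (g + X * derivative ℝ g) * g ^ (a + 1)))
      = ∑ j ∈ Finset.range (N + 1),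
        c * (a + 1 + N) * (j * y ^ (j - 1)) / ((a + 1 + j) * j.factorial) * A j := by
    rw [← hB _ (by simp), Finset.mul_sum]
    refine Finset.sum_congr rfl fun j hj => ?_
    rw [h2 j (Finset.mem_range.1 hj), Nat.factorial_succ, Nat.add_sub_cancel]
    have : (a : ℝ) + j + 2 ≠ 0 := by positivity
    have : (a : ℝ) + 1 + (j + 1) ≠ 0 := by positivity
    have : (j : ℝ) + 1 ≠ 0 := by positivity
    have : (j.factorial : ℝ) ≠ 0 := by positivity
    push_cast
    field_simp
    ring
  rw [h4, ← Finset.sum_add_distrib, Finset.mul_sum]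
  refine Finset.sum_congr rfl fun j hj => ?_
  have hj : j ≤ N := Nat.lt_succ_iff.1 (Finset.mem_range.1 hj)
  rw [h1, show r * N + v.succ + j = a + 1 + j by omega]
  change _ = N * (A j / _ * _)
  have ht : (a : ℝ) + 1 + j ≠ 0 := by positivity
  have ht' : (a : ℝ) + j + 1 ≠ 0 := by positivity
  have hf : (j.factorial : ℝ) ≠ 0 := by positivity
  -- Source of the constant `(r+1)c - b`: the `y` part merges with the first sum, and the rest
  -- carries the factor `N`.
  have hya : c * ((a : ℝ) + 1 + N) = y + N * ((r + 1) * c - b) := by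
    rw [hy, ha]; push_cast; ring
  have hp : (j : ℝ) * y ^ j = j * y ^ (j - 1) * y := by
    cases j with
    | zero => simp
    | succ j => rw [Nat.add_sub_cancel, pow_succ]; ring
  rw [hya]
  push_cast [hj]
  field_simp
  linear_combination (-(A j * (a + 1 + j))) * hp

/-! ### Bell polynomials and the families `Ybc`, `Yz`. -/

theorem partialBell_add (x : ℕ → ℝ) (N k : ℕ) :
    partialBell x (k + N) k = (k + N).factorial / k.factorial *
      coeff N ((mk fun m => x (m + 1) / (m + 1).factorial) ^ k) := by
  have h : (PowerSeries.mk fun m : ℕ => if m = 0 then (0 : ℝ) else x m / (m.factorial : ℝ))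
      = X * mk fun m => x (m + 1) / (m + 1).factorial := by
    ext m
    cases m with
    | zero => simp
    | succ m => rw [coeff_succ_X_mul]; simp
  rw [partialBell, h, coeff_C_mul, mul_pow, add_comm k N, coeff_X_pow_mul]
  ring

/-- `Ybc` in terms of coefficients of powers of the inverted series. -/
theorem Ybc_add (x : ℕ → ℝ) (r s : ℕ) (b c : ℝ) (hrs : 1 ≤ r + s) {H : ℝ⟦X⟧}
    (hH : ∀ k : ℕ,
      constantCoeff (H ^ k) = constantCoeff
        (((mk fun m => x (m + 1) / (m + 1).factorial) *
          expMul (mk fun m => x (m + 1) / (m + 1).factorial) c) ^ k) ∧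
      ∀ N : ℕ, N * coeff N (H ^ k) = coeff N (X * derivative ℝ
        (((mk fun m => x (m + 1) / (m + 1).factorial) *
          expMul (mk fun m => x (m + 1) / (m + 1).factorial) c) ^ k) *
        ((mk fun m => x (m + 1) / (m + 1).factorial) ^ r *
          expMul (mk fun m => x (m + 1) / (m + 1).factorial) b) ^ N))
    (N k : ℕ) (hk : 1 ≤ k) :
    Ybc x r s b c (k + N) k = (k + N).factorial / k.factorial * coeff N (H ^ (s * k)) := by
  set g : ℝ⟦X⟧ := mk fun m => x (m + 1) / (m + 1).factorial with hg
  have hkf : (k.factorial : ℝ) ≠ 0 := by positivity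
  have hT : T r s (k + N) k = r * N + s * k := by simp [T]
  rcases Nat.eq_zero_or_pos s with rfl | hs
  · rcases Nat.eq_zero_or_pos N with rfl | hN
    · simp [Ybc, prefactor, ratio, T, partialBell, hkf]
    · have : r ≠ 0 := by omega
      have : ratio r 0 (k + N) k = 0 := by
        rw [ratio, hT, if_neg (by positivity)]; simp
      simp [Ybc, prefactor, this, coeff_one, hN.ne']
  have hu : s * k ≠ 0 := by positivity
  have key : coeff N (H ^ (s * k)) = (s * k : ℕ) * ∑ j ∈ Finset.range (N + 1),
          coeff (N - j) (g ^ (r * N + s * k + j)) /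
            (((r * N + s * k + j : ℕ) : ℝ) * j.factorial) *
          ((b * N + c * (s * k : ℕ)) ^ j
            + (((r : ℝ) + 1) * c - b) * j * (b * N + c * (s * k : ℕ)) ^ (j - 1)) := by
    -- At `N = 0` the Lagrange formula reads `0 = 0`, so constant terms are compared directly.
    rcases Nat.eq_zero_or_pos N with rfl | hN
    · have h0 : (((s * k : ℕ) : ℝ)) ≠ 0 := by exact_mod_cast hu
      rw [coeff_zero_eq_constantCoeff_apply, (hH _).1, mul_pow, map_mul]
      have : constantCoeff (expMul g c) = 1 := by
        have := coeff_expMul_mul g 1 c 0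
        simpa using this
      simp only [map_pow, this]
      simp
      field_simp
    · have h := (hH (s * k)).2 N
      rw [coeff_X_mul_derivative_mul_expMul g b c r (s * k) N hu] at h
      have hN' : (N : ℝ) ≠ 0 := by positivity
      exact mul_left_cancel₀ hN' h
  rw [key]
  obtain ⟨t, ht⟩ : ∃ t, r * N + s * k = t + 1 :=
    Nat.exists_eq_succ_of_ne_zero (by positivity)
  have hy : b * ((k + N - k : ℕ) : ℝ) + c * (s : ℝ) * (k : ℝ) = b * N + c * (s * k : ℕ) := by
    rw [Nat.add_sub_cancel_left]; push_cast; ring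
  simp only [Ybc, hy]
  rw [prefactor, ratio, hT, ht, if_neg (Nat.succ_ne_zero t), Nat.add_sub_cancel_left,
    Nat.cast_add_choose, (Nat.choose_symm_add : (t + 1 + N).choose (t + 1) = _).symm,
    Nat.cast_add_choose, Finset.mul_sum, Finset.mul_sum, Finset.mul_sum]
  refine Finset.sum_congr rfl fun j hj => ?_
  have hj : j ≤ N := Nat.lt_succ_iff.1 (Finset.mem_range.1 hj)
  rw [show t + 1 + N = t + 1 + j + (N - j) by omega, partialBell_add, ← hg,
    show t + 1 + j - 1 = t + j by omega, Nat.add_sub_cancel, Nat.cast_add_choose,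
    show t + 1 + j = t + j + 1 by ring, Nat.factorial_succ (t + j), Nat.factorial_succ t]
  have : ((t + j + 1 + (N - j)).factorial : ℝ) ≠ 0 := by positivity
  have : ((t + j).factorial : ℝ) ≠ 0 := by positivity
  have : (t.factorial : ℝ) ≠ 0 := by positivity
  have : (j.factorial : ℝ) ≠ 0 := by positivity
  have : (N.factorial : ℝ) ≠ 0 := by positivity
  have : (t : ℝ) + 1 ≠ 0 := by positivity
  have : (t : ℝ) + j + 1 ≠ 0 := by positivity
  push_cast
  field_simp

theorem satisfiesBellEq_Ybc (x : ℕ → ℝ) (r s : ℕ) (hrs : 1 ≤ r + s) (b c : ℝ) :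
    SatisfiesBellEq (Ybc x r s b c) := by
  intro n k hk hkn
  obtain ⟨N, rfl⟩ := Nat.exists_eq_add_of_le hkn
  obtain ⟨H, hH⟩ := exists_lagrange_inversion
    ((mk fun m => x (m + 1) / (m + 1).factorial) ^ r *
      expMul (mk fun m => x (m + 1) / (m + 1).factorial) b)
    ((mk fun m => x (m + 1) / (m + 1).factorial) *
      expMul (mk fun m => x (m + 1) / (m + 1).factorial) c)
  -- The case `k = 1` identifies the generating series `G`.
  have h1 : (mk fun m => Ybc x r s b c (m + 1) 1 / (m + 1).factorial) = H ^ s := by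
    ext m
    have hm : ((m + 1).factorial : ℝ) ≠ 0 := by positivity
    rw [coeff_mk, add_comm m 1, Ybc_add x r s b c hrs hH m 1 le_rfl, add_comm 1 m, mul_one,
      Nat.factorial_one, Nat.cast_one, div_one]
    field_simp
  rw [partialBell_add, h1, ← pow_mul, Ybc_add x r s b c hrs hH N k hk]

/-- For `b = (r+1)z`, `c = z` the correction term vanishes and `y = (T + n - k) z`. -/
theorem Yz_eq_Ybc (x : ℕ → ℝ) (r s : ℕ) (z : ℝ) :
    Yz x r s z = Ybc x r s ((r + 1) * z) z := by
  funext n k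
  simp only [Yz, Ybc]
  congr 1
  refine Finset.sum_congr rfl fun j _ => ?_
  rw [sub_self, zero_mul, zero_mul, add_zero, mul_assoc _ (_ ^ j) (z ^ j), ← mul_pow]
  congr 2
  rw [T]
  push_cast
  ring

end BellIdentities

theorem mainTheorem7 (x : ℕ → ℝ) (r s : ℕ) (hrs : 1 ≤ r + s) :
    (∀ b c : ℝ, BellIdentities.SatisfiesBellEq (BellIdentities.Ybc x r s b c)) ∧
      (∀ z : ℝ, BellIdentities.SatisfiesBellEq (BellIdentities.Yz x r s z)) := by
  refine ⟨BellIdentities.satisfiesBellEq_Ybc x r s hrs, fun z => ?_⟩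
  rw [BellIdentities.Yz_eq_Ybc]
  exact BellIdentities.satisfiesBellEq_Ybc x r s hrs _ _
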